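/- Let $\mathcal E$ be a complex separable Hilbert space and $k\ge 1$. The truncated shift of index $k$ is the operator $J_k(x_1,x_2,\dots,x_k)=(0,x_1,\dots,x_{k-1})$ on $\mathbb E_k=\mathcal E\otimes\mathbb C^k=\mathcal E\oplus\cdots\oplus\mathcal E$ ($k$ times); in particular $J_1=0$. For a complex separable Hilbert space $\mathcal G$, let $H^2_{\mathcal G}(\mathbb D)$ be the Hardy space of $\mathcal G$-valued analytic functions on the unit disc $\mathbb D$, regarded through radial limits as the closed subspace of $L^2_{\mathcal G}(\mathbb T)$ of functions whose negative Fourier coefficients vanish. Let $H^\infty_{\mathcal B(\mathcal G,\mathcal G')}$ be the space of bounded analytic functions $\Psi:\mathbb D\to\mathcal B(\mathcal G,\mathcal G')$, with boundary values $\Psi(e^{it})$ given by radial limits in the strong operator topology. Such a $\Psi$ is called inner if $\Psi(e^{it})^*\Psi(e^{it})=I_{\mathcal G}$ for almost every $e^{it}\in\mathbb T$, and $T_\Psi:H^2_{\mathcal G}(\mathbb D)\to H^2_{\mathcal G'}(\mathbb D)$ is the Toeplitz operator $T_\Psi h=P_+(\Psi h)$, where $P_+$ is the orthogonal projection of $L^2_{\mathcal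 G'}(\mathbb T)$ onto $H^2_{\mathcal G'}(\mathbb D)$. Let $M_{z^k}^{\mathcal E}$ be multiplication by $z^k$ on $H^2_{\mathcal E}(\mathbb D)$. Identify $\mathbb E_k$ with the subspace $[z^kH^2_{\mathcal E}(\mathbb D)]^\perp$ of $H^2_{\mathcal E}(\mathbb D)$ through $(x_1,\dots,x_k)\mapsto\sum_{m=0}^{k-1}x_{m+1}z^m$. Theorem. A closed subspace $\mathcal M$ of $\mathbb E_k$ is invariant under $J_k$ if and only if there exist a Hilbert space $\mathcal F$ isomorphic to $\mathcal E$ and inner functions $\Theta\in H^\infty_{\mathcal B(\mathcal F,\mathcal E)}$ and $\Phi\in H^\infty_{\mathcal B(\mathcal E,\mathcal F)}$ such that $$T_\Theta T_\Phi=M_{z^k}^{\mathcal E}\qquad\text{and}\qquad \mathcal M=T_\Theta\bigl(\ker T_\Phi^*\bigr).$$ -/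

import Mathlib

open MeasureTheory Filter Topology
open scoped ENNReal

universe u

namespace HardyShift

/-- The unit circle, parametrized by `t ∈ ℝ/ℤ` through `t ↦ e^{2πit}` (which is
`AddCircle.toCircle t`); it carries the normalized Lebesgue measure `μT`. -/
abbrev 𝕋 : Type := AddCircle (1 : ℝ)

/-- Normalized Lebesgue measure on the circle. -/
noncomputable abbrev μT : Measure 𝕋 := AddCircle.haarAddCircle

/-- `L²_E`: square-integrable `E`-valued functions on the circle (modulo a.e. equality). -/
noncomputable abbrev L2 (E : Type u) [NormedAddCommGroup E] : Type u := Lp E 2 μT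

section Hardy

variable (E : Type u) [NormedAddCommGroup E] [InnerProductSpace ℂ E] [CompleteSpace E]

/-- The `n`-th Fourier coefficient as a bounded linear map `L²_E → E`. -/
noncomputable def coeffL (n : ℤ) : L2 E →L[ℂ] E :=
  LinearMap.mkContinuous
    { toFun := fun f => fourierCoeff (f : 𝕋 → E) n
      map_add' := by
        intro f g
        have hf : Integrable (f : 𝕋 → E) μT := (Lp.memLp f).integrable (by norm_num)
        have hg : Integrable (g : 𝕋 → E) μT := (Lp.memLp g).integrable (by norm_num)
        rw [← Pi.add_apply, ← fourierCoeff.add hf hg]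
        refine integral_congr_ae ?_
        filter_upwards [Lp.coeFn_add f g] with t ht
        rw [ht]
      map_smul' := by
        intro c f
        simp only [RingHom.id_apply]
        rw [fourierCoeff, fourierCoeff, ← integral_smul]
        refine integral_congr_ae ?_
        filter_upwards [Lp.coeFn_smul c f] with t ht
        rw [ht, Pi.smul_apply, smul_comm] }
    1 (by
      intro f
      have hf : MemLp (f : 𝕋 → E) 2 μT := Lp.memLp f
      have hf1 : MemLp (f : 𝕋 → E) 1 μT := hf.mono_exponent (by norm_num)
      change ‖fourierCoeff (f : 𝕋 → E) n‖ ≤ 1 * ‖f‖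
      calc ‖fourierCoeff (f : 𝕋 → E) n‖
          ≤ ∫ t, ‖fourier (-n) t • f t‖ ∂μT := norm_integral_le_integral_norm _
        _ = ∫ t, ‖f t‖ ∂μT := by
            refine integral_congr_ae (Eventually.of_forall fun t => ?_)
            simp only [norm_smul, fourier_apply, Circle.norm_coe, one_mul]
        _ = (eLpNorm (f : 𝕋 → E) 1 μT).toReal := by
            rw [integral_norm_eq_lintegral_enorm hf1.1, eLpNorm_one_eq_lintegral_enorm]
        _ ≤ (eLpNorm (f : 𝕋 → E) 2 μT).toReal :=
            ENNReal.toReal_mono hf.2.ne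
              (eLpNorm_le_eLpNorm_of_exponent_le (by norm_num) hf.1)
        _ = 1 * ‖f‖ := by rw [one_mul, Lp.norm_def])

/-- The Hardy space `H²_E`, as the closed subspace of `L²_E` of (boundary values of) analytic
functions, i.e. of those functions all of whose negative Fourier coefficients vanish. -/
noncomputable def H2 : Submodule ℂ (L2 E) where
  carrier := {f | ∀ n : ℤ, n < 0 → fourierCoeff (f : 𝕋 → E) n = 0}
  add_mem' := by
    intro f g hf hg n hn
    have h := map_add (coeffL E n) f g
    change fourierCoeff _ n = fourierCoeff _ n + fourierCoeff _ n at h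
    rw [h, hf n hn, hg n hn, add_zero]
  zero_mem' := by
    intro n hn
    exact map_zero (coeffL E n)
  smul_mem' := by
    intro c f hf n hn
    have h := map_smul (coeffL E n) c f
    change fourierCoeff _ n = c • fourierCoeff _ n at h
    rw [h, hf n hn, smul_zero]

theorem isClosed_H2 : IsClosed (H2 E : Set (L2 E)) := by
  have : (H2 E : Set (L2 E)) = ⋂ n : ℤ, ⋂ _ : n < 0, {f | coeffL E n f = 0} := by
    ext f
    simp only [Set.mem_iInter, Set.mem_ofPred_eq]
    rfl
  rw [this]
  exact isClosed_iInter fun n => isClosed_iInter fun _ =>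
    isClosed_eq (coeffL E n).continuous continuous_const

noncomputable instance : CompleteSpace (H2 E) := (isClosed_H2 E).completeSpace_coe

variable {E}

/-- The function `e^{it} ↦ e^{imt} x` in `L²_E`. -/
noncomputable def monoL2 (m : ℕ) : E →ₗ[ℂ] L2 E where
  toFun x := ContinuousMap.toLp (E := E) 2 μT ℂ
    ⟨fun t => fourier (m : ℤ) t • x, by fun_prop⟩
  map_add' x y := by
    rw [← map_add]
    congr 1
    ext t
    exact smul_add _ _ _
  map_smul' c x := by
    rw [RingHom.id_apply, ← map_smul]
    congr 1
    ext t
    exact smul_comm _ _ _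

theorem monoL2_mem (m : ℕ) (x : E) : monoL2 m x ∈ H2 E := by
  intro n hn
  have h1 : fourierCoeff (monoL2 m x : 𝕋 → E) n
      = ∫ t : 𝕋, (fourier (-n) t * fourier (m : ℤ) t) • x ∂μT := by
    refine integral_congr_ae ?_
    have := ContinuousMap.coeFn_toLp (E := E) (p := 2) μT (𝕜 := ℂ)
      (⟨fun t => fourier (m : ℤ) t • x, by fun_prop⟩ : C(𝕋, E))
    filter_upwards [this] with t ht
    have ht' : (monoL2 m x : 𝕋 → E) t = fourier (m : ℤ) t • x := ht
    rw [ht', smul_smul]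
  rw [h1, integral_smul_const]
  have hne : -n + (m : ℤ) ≠ 0 := by omega
  have h2 : ∫ t : 𝕋, fourier (-n) t * fourier (m : ℤ) t ∂μT = 0 := by
    simp_rw [← fourier_add]
    exact integral_eq_zero_of_add_right_eq_neg (μ := μT)
      (fourier_add_half_inv_index hne (by norm_num))
  rw [h2, zero_smul]

/-- The monomial `z^m x` in `H²_E`, as a linear function of `x ∈ E`. -/
noncomputable def monomial (m : ℕ) : E →ₗ[ℂ] H2 E :=
  (monoL2 m).codRestrict (H2 E) (monoL2_mem m)

end Hardy

section Symbols

variable (E F : Type u) [NormedAddCommGroup E] [InnerProductSpace ℂ E]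
  [NormedAddCommGroup F] [InnerProductSpace ℂ F]

/-- `L^∞_{B(E,F)}`: essentially bounded, strongly measurable operator-valued functions on the
circle. -/
structure LInfty where
  /-- the underlying function -/
  toFun : 𝕋 → E →L[ℂ] F
  meas : ∀ x : E, AEStronglyMeasurable (fun t => toFun t x) μT
  bdd : ∃ C : ℝ, 0 ≤ C ∧ ∀ᵐ t ∂μT, ‖toFun t‖ ≤ C

/-- `H^∞_{B(E,F)}`: bounded analytic operator-valued functions on the open unit disc. (The values
outside the disc are irrelevant.) -/
structure HInfty where
  /-- the underlying function -/
  toFun : ℂ → E →L[ℂ] F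
  analytic : DifferentiableOn ℂ toFun (Metric.ball 0 1)
  bdd : ∃ C : ℝ, ∀ z ∈ Metric.ball (0 : ℂ) 1, ‖toFun z‖ ≤ C

variable {E F}

theorem LInfty.aestronglyMeasurable_apply (Φ : LInfty E F) {f : 𝕋 → E}
    (hf : AEStronglyMeasurable f μT) : AEStronglyMeasurable (fun t => Φ.toFun t (f t)) μT := by
  obtain ⟨g, hg, hfg⟩ := hf
  have hs : ∀ s : SimpleFunc 𝕋 E, AEStronglyMeasurable (fun t => Φ.toFun t (s t)) μT := by
    intro s
    have : (fun t => Φ.toFun t (s t)) = fun t => ∑ y ∈ s.range,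
        (s ⁻¹' {y}).indicator (fun t => Φ.toFun t y) t := by
      ext t
      rw [Finset.sum_eq_single (s t)]
      · simp
      · intro y _ hy
        exact Set.indicator_of_notMem (by simpa using fun h => hy h.symm) _
      · intro h
        exact absurd (s.mem_range_self t) h
    rw [this]
    exact Finset.aestronglyMeasurable_fun_sum _ fun y _ =>
      (Φ.meas y).indicator (s.measurableSet_fiber y)
  have hlim : AEStronglyMeasurable (fun t => Φ.toFun t (g t)) μT :=
    aestronglyMeasurable_of_tendsto_ae atTop (fun n => hs (hg.approx n))
      (Eventually.of_forall fun t =>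
        ((Φ.toFun t).continuous.tendsto _).comp (hg.tendsto_approx t))
  refine hlim.congr ?_
  filter_upwards [hfg] with t ht
  rw [ht]

theorem LInfty.memLp_apply (Φ : LInfty E F) (f : L2 E) :
    MemLp (fun t => Φ.toFun t (f t)) 2 μT := by
  obtain ⟨C, hC, hb⟩ := Φ.bdd
  refine (Lp.memLp f).of_le_mul (c := C) (Φ.aestronglyMeasurable_apply (Lp.memLp f).1) ?_
  filter_upwards [hb] with t ht
  exact (Φ.toFun t).le_of_opNorm_le ht _

/-- The Laurent (multiplication) operator `L_Φ : L²_E → L²_F`, `(L_Φ f)(t) = Φ(t) f(t)`. -/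
noncomputable def LInfty.laurent (Φ : LInfty E F) : L2 E →L[ℂ] L2 F :=
  LinearMap.mkContinuous
    { toFun := fun f => (Φ.memLp_apply f).toLp
      map_add' := by
        intro f g
        rw [← MemLp.toLp_add]
        refine MemLp.toLp_congr _ _ ?_
        filter_upwards [Lp.coeFn_add f g] with t ht
        rw [ht]
        exact map_add (Φ.toFun t) (f t) (g t)
      map_smul' := by
        intro c f
        rw [RingHom.id_apply, ← MemLp.toLp_const_smul]
        refine MemLp.toLp_congr _ _ ?_
        filter_upwards [Lp.coeFn_smul c f] with t ht
        rw [ht]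
        exact map_smul (Φ.toFun t) c (f t) }
    Φ.bdd.choose (by
      intro f
      refine Lp.norm_le_mul_norm_of_ae_le_mul ?_
      filter_upwards [(Φ.memLp_apply f).coeFn_toLp, Φ.bdd.choose_spec.2] with t h1 h2
      change ‖((Φ.memLp_apply f).toLp : 𝕋 → F) t‖ ≤ _
      rw [h1]
      exact (Φ.toFun t).le_of_opNorm_le h2 _)

/-- The Toeplitz operator `T_Φ : H²_E → H²_F`, `T_Φ h = P_+(Φ h)`, where `P_+` is the orthogonal
projection of `L²_F` onto `H²_F`. -/
noncomputable def LInfty.toeplitz [CompleteSpace E] [CompleteSpace F] (Φ : LInfty E F) :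
    H2 E →L[ℂ] H2 F :=
  (H2 F).orthogonalProjectionOnto ∘L Φ.laurent ∘L (H2 E).subtypeL

variable (E) in
/-- The symbol `z^k I_E` on the circle. -/
noncomputable def zPow (k : ℕ) : LInfty E E where
  toFun t := fourier (k : ℤ) t • ContinuousLinearMap.id ℂ E
  meas x := by
    apply Continuous.aestronglyMeasurable
    simp only [smul_apply, ContinuousLinearMap.id_apply]
    fun_prop
  bdd := by
    refine ⟨1, zero_le_one, Eventually.of_forall fun t => ?_⟩
    rw [norm_smul, fourier_apply, Circle.norm_coe, one_mul]
    exact ContinuousLinearMap.norm_id_le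

variable (E) in
/-- `M_{z^k}` on `H²_E`: multiplication by `z^k`. -/
noncomputable def Mz [CompleteSpace E] (k : ℕ) : H2 E →L[ℂ] H2 E := (zPow E k).toeplitz

/-- `φ` is the radial boundary function of `Θ`: for almost every `t`, `Θ(r e^{2πit})` tends to
`φ t` in the strong operator topology as `r ↑ 1`. -/
def HInfty.IsRadialLimit (Θ : HInfty E F) (φ : 𝕋 → E →L[ℂ] F) : Prop :=
  ∀ᵐ t ∂μT, ∀ x : E,
    Tendsto (fun r : ℝ => Θ.toFun ((r : ℂ) * (AddCircle.toCircle t : ℂ)) x) (𝓝[<] 1) (𝓝 (φ t x))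

theorem HInfty.mul_mem_ball {r : ℝ} (h0 : 0 ≤ r) (h1 : r < 1) (t : 𝕋) :
    (r : ℂ) * (AddCircle.toCircle t : ℂ) ∈ Metric.ball (0 : ℂ) 1 := by
  rw [mem_ball_zero_iff, norm_mul, Circle.norm_coe, mul_one, Complex.norm_real,
    Real.norm_of_nonneg h0]
  exact h1

theorem HInfty.IsRadialLimit.meas {Θ : HInfty E F} {φ : 𝕋 → E →L[ℂ] F}
    (h : Θ.IsRadialLimit φ) (x : E) : AEStronglyMeasurable (fun t => φ t x) μT := by
  obtain ⟨u, -, hu, hlim⟩ := exists_seq_strictMono_tendsto' (zero_lt_one' ℝ)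
  have hlim' : Tendsto u atTop (𝓝[<] 1) :=
    tendsto_nhdsWithin_iff.2 ⟨hlim, Eventually.of_forall fun n => (hu n).2⟩
  refine aestronglyMeasurable_of_tendsto_ae atTop
    (f := fun n t => Θ.toFun ((u n : ℂ) * (AddCircle.toCircle t : ℂ)) x) (fun n => ?_) ?_
  · apply Continuous.aestronglyMeasurable
    have hc : Continuous fun t : 𝕋 => ((u n : ℂ) * (AddCircle.toCircle t : ℂ)) :=
      continuous_const.mul (continuous_subtype_val.comp AddCircle.continuous_toCircle)
    exact (Θ.analytic.continuousOn.comp_continuous hc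
      (fun t => HInfty.mul_mem_ball (hu n).1.le (hu n).2 t)).clm_apply continuous_const
  · filter_upwards [h] with t ht
    exact (ht x).comp hlim'

theorem HInfty.IsRadialLimit.bdd {Θ : HInfty E F} {φ : 𝕋 → E →L[ℂ] F}
    (h : Θ.IsRadialLimit φ) : ∃ C : ℝ, 0 ≤ C ∧ ∀ᵐ t ∂μT, ‖φ t‖ ≤ C := by
  obtain ⟨C, hC⟩ := Θ.bdd
  have hC0 : 0 ≤ C := (norm_nonneg _).trans (hC 0 (by simp))
  refine ⟨C, hC0, ?_⟩
  filter_upwards [h] with t ht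
  refine ContinuousLinearMap.opNorm_le_bound _ hC0 fun x => ?_
  refine le_of_tendsto (ht x).norm ?_
  filter_upwards [Ioo_mem_nhdsLT (zero_lt_one' ℝ)] with r hr
  exact (Θ.toFun _).le_of_opNorm_le (hC _ (HInfty.mul_mem_ball hr.1.le hr.2 t)) _

open Classical in
/-- The radial boundary function of a bounded analytic function, as an element of
`L^∞_{B(E,F)}`. For separable Hilbert spaces it exists by Fatou's theorem, and it is unique up to
a set of measure zero. -/
noncomputable def HInfty.boundary (Θ : HInfty E F) : LInfty E F :=
  if h : ∃ φ, Θ.IsRadialLimit φ then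
    { toFun := h.choose
      meas := h.choose_spec.meas
      bdd := h.choose_spec.bdd }
  else
    { toFun := 0
      meas := fun _ => aestronglyMeasurable_const
      bdd := ⟨0, le_rfl, Eventually.of_forall fun _ => by simp⟩ }

/-- The analytic Toeplitz operator `T_Θ : H²_E → H²_F` with symbol `Θ ∈ H^∞_{B(E,F)}`. -/
noncomputable def HInfty.toeplitz [CompleteSpace E] [CompleteSpace F] (Θ : HInfty E F) :
    H2 E →L[ℂ] H2 F :=
  Θ.boundary.toeplitz

/-- `Θ` is inner: `Θ(e^{it})^* Θ(e^{it}) = I_E` for almost every point of the circle. -/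
def HInfty.IsInner [CompleteSpace E] [CompleteSpace F] (Θ : HInfty E F) : Prop :=
  ∀ᵐ t ∂μT, (ContinuousLinearMap.adjoint (Θ.boundary.toFun t)) ∘L (Θ.boundary.toFun t)
    = ContinuousLinearMap.id ℂ E

end Symbols

section TruncatedShift

variable (E : Type u) [NormedAddCommGroup E] [InnerProductSpace ℂ E]

/-- `E ⊗ ℂ^k`, i.e. the Hilbert space direct sum of `k` copies of `E`. -/
abbrev Ek (k : ℕ) : Type u := PiLp 2 (fun _ : Fin k => E)

/-- The truncated shift `J_k (x₁, …, x_k) = (0, x₁, …, x_{k-1})` (so `J₁ = 0`). -/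
noncomputable def J (k : ℕ) : Ek E k →L[ℂ] Ek E k :=
  (PiLp.continuousLinearEquiv 2 ℂ (fun _ : Fin k => E)).symm.toContinuousLinearMap ∘L
    (ContinuousLinearMap.pi fun i : Fin k =>
      if 0 < i.val then
        ContinuousLinearMap.proj (R := ℂ) (φ := fun _ : Fin k => E)
          (⟨i.val - 1, (Nat.sub_le _ _).trans_lt i.isLt⟩ : Fin k)
      else 0) ∘L
    (PiLp.continuousLinearEquiv 2 ℂ (fun _ : Fin k => E)).toContinuousLinearMap

/-- The identification of `E ⊗ ℂ^k` with `[z^k H²_E]^⊥ ⊆ H²_E`: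
`(x₁, …, x_k) ↦ x₁ + z x₂ + ⋯ + z^{k-1} x_k`. -/
noncomputable def embed [CompleteSpace E] (k : ℕ) : Ek E k →ₗ[ℂ] H2 E where
  toFun x := ∑ i : Fin k, monomial i.val (x i)
  map_add' x y := by simp [Finset.sum_add_distrib]
  map_smul' c x := by simp [Finset.smul_sum]

end TruncatedShift

end HardyShift

namespace HardyShift

/-! ### Fourier coefficients of `L²` functions -/

section FourierCoeff

variable {E : Type u} [NormedAddCommGroup E] [InnerProductSpace ℂ E]

/-! Taking the first `k` Taylor coefficients intertwines multiplication by `z` on `H²` with `J`, so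
the preimage `N` of a closed `J`-invariant `M` is a closed shift-invariant subspace containing `z^k
H²`. Such an `N` equals `Θ H²` for a product `Θ` of `k` Blaschke–Potapov factors `P + z(1 - P)`.
Each factor has a complement `zP + (1 - P)`, and their product is `z`; the complements multiply to
an inner `Φ` with `Θ Φ = z^k` (`exists_potapov`, `exists_factorization`). Since `T_Θ` is isometric,
`M = Θ H² ⊖ Θ Φ H² = Θ (H² ⊖ Φ H²) = Θ (ker T_Φ^*)`. All symbols are polynomials on `E` itself, so
`F = E` works and neither Beurling–Lax nor Fatou is needed.

Conversely, for `h` in `ker T_Φ^*`, projecting `zh` back to the kernel subtracts an element of `Φ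
H²`, which `Θ` sends into `z^k H²`, where truncation kills it (`J_mem_of_factorization`). This rests
on `HInfty.coeFn_toeplitz`: for an analytic symbol the projection `P_+` does nothing. -/

theorem fourierCoeff_fourier_smul (f : 𝕋 → E) (m n : ℤ) :
    fourierCoeff (fun t => fourier m t • f t) n = fourierCoeff f (n - m) := by
  refine integral_congr_ae (Eventually.of_forall fun t => ?_)
  simp only [smul_smul, ← fourier_add]
  congr 2
  congr 1
  ring

theorem fourierCoeff_fourier_smul_const [CompleteSpace E] (m n : ℤ) (x : E) :
    fourierCoeff (fun t : 𝕋 => fourier m t • x) n = if n = m then x else 0 := by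
  have h := congrFun (fourierCoeff_fourier (T := 1) m) n
  rw [fourierCoeff] at h ⊢
  simp only [smul_smul, smul_eq_mul] at h ⊢
  rw [integral_smul_const, h, Pi.single_apply]
  split_ifs <;> simp

theorem norm_fourier_apply (n : ℤ) (t : 𝕋) : ‖fourier n t‖ = 1 := by
  rw [fourier_apply, Circle.norm_coe]

/-- An `L²` function all of whose Fourier coefficients vanish is zero. -/
theorem L2.eq_zero_of_fourierCoeff_eq_zero [CompleteSpace E] [TopologicalSpace.SeparableSpace E]
    (f : L2 E) (hf : ∀ n : ℤ, fourierCoeff (f : 𝕋 → E) n = 0) : f = 0 := by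
  rw [Lp.eq_zero_iff_ae_eq_zero]
  refine ae_eq_zero_of_forall_inner (𝕜 := ℂ) fun c => ?_
  have hint : Integrable (f : 𝕋 → E) μT := (Lp.memLp f).integrable (by norm_num)
  have hmem : MemLp (fun t => inner ℂ c (f t)) 2 μT := (Lp.memLp f).const_inner c
  have h0 : hmem.toLp = 0 := by
    -- Pairing with a constant vector reduces the claim to completeness of the scalar Fourier basis.
    apply (fourierBasis (T := 1)).repr.injective
    rw [map_zero]
    ext n
    rw [fourierBasis_repr]
    have : fourierCoeff (hmem.toLp : 𝕋 → ℂ) n = inner ℂ c (fourierCoeff (f : 𝕋 → E) n) := by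
      rw [fourierCoeff_congr_ae hmem.coeFn_toLp, fourierCoeff, fourierCoeff,
        ← integral_inner (hint.fourier_smul _)]
      refine integral_congr_ae (Eventually.of_forall fun t => ?_)
      simp [inner_smul_right]
    rw [this, hf, inner_zero_right]
    rfl
  exact hmem.coeFn_toLp.symm.trans ((Lp.eq_zero_iff_ae_eq_zero).1 h0)

end FourierCoeff

/-! ### The Hardy space -/

section Hardy

variable {E : Type u} [NormedAddCommGroup E] [InnerProductSpace ℂ E] [CompleteSpace E]

theorem H2.coeFn_monomial (m : ℕ) (x : E) :
    ((monomial m x : L2 E) : 𝕋 → E) =ᵐ[μT] fun t => fourier (m : ℤ) t • x :=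
  ContinuousMap.coeFn_toLp (E := E) (p := 2) μT (𝕜 := ℂ)
    (⟨fun t => fourier (m : ℤ) t • x, by fun_prop⟩ : C(𝕋, E))

theorem H2.norm_monomial (m : ℕ) (x : E) : ‖monomial m x‖ = ‖x‖ := by
  change ‖(monomial m x : L2 E)‖ = _
  rw [Lp.norm_def, eLpNorm_congr_norm_ae (g := fun _ => x), eLpNorm_const _ (by norm_num)
    (NeZero.ne _)]
  · simp
  · filter_upwards [H2.coeFn_monomial m x] with t ht
    rw [ht, norm_smul, norm_fourier_apply, one_mul]

theorem H2.continuous_monomial (m : ℕ) : Continuous (monomial m : E → H2 E) :=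
  (⟨monomial m, H2.norm_monomial m⟩ : E →ₗᵢ[ℂ] H2 E).continuous

/-- The `n`-th Taylor coefficient of a function in `H²_E`. -/
noncomputable def H2.coeff (n : ℕ) : H2 E →L[ℂ] E := coeffL E n ∘L (H2 E).subtypeL

omit [CompleteSpace E] in
theorem H2.coeff_apply (n : ℕ) (f : H2 E) : H2.coeff n f = fourierCoeff ((f : L2 E) : 𝕋 → E) n :=
  rfl

theorem H2.coeff_monomial (n m : ℕ) (x : E) :
    H2.coeff n (monomial m x) = if n = m then x else 0 := by
  rw [H2.coeff_apply, fourierCoeff_congr_ae (H2.coeFn_monomial m x),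
    fourierCoeff_fourier_smul_const]
  simp

theorem H2.inner_monomial (m : ℕ) (x : E) (f : H2 E) :
    inner ℂ (monomial m x) f = inner ℂ x (H2.coeff m f) := by
  have hint : Integrable ((f : L2 E) : 𝕋 → E) μT := (Lp.memLp _).integrable (by norm_num)
  change inner ℂ (monomial m x : L2 E) (f : L2 E) = _
  rw [H2.coeff_apply, fourierCoeff, ← integral_inner (hint.fourier_smul _), L2.inner_def]
  refine integral_congr_ae ?_
  filter_upwards [H2.coeFn_monomial m x] with t ht
  rw [ht, inner_smul_left, inner_smul_right, ← fourier_neg]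

variable [TopologicalSpace.SeparableSpace E]

theorem H2.eq_zero_of_coeff_eq_zero (f : H2 E) (hf : ∀ n, H2.coeff n f = 0) : f = 0 := by
  refine Subtype.ext (L2.eq_zero_of_fourierCoeff_eq_zero _ fun n => ?_)
  rcases lt_or_ge n 0 with hn | hn
  · exact f.2 n hn
  · lift n to ℕ using hn
    exact hf n

/-- A closed subspace of `H²_E` containing all monomials is everything. -/
theorem H2.eq_top_of_monomial_mem (N : Submodule ℂ (H2 E)) (hN : IsClosed (N : Set (H2 E)))
    (h : ∀ n x, monomial n x ∈ N) : N = ⊤ := by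
  have : CompleteSpace N := hN.completeSpace_coe
  rw [← Submodule.orthogonal_eq_bot_iff, Submodule.eq_bot_iff]
  intro f hf
  refine H2.eq_zero_of_coeff_eq_zero f fun n => ?_
  have := (Submodule.mem_orthogonal _ _).1 hf _ (h n (H2.coeff n f))
  rwa [H2.inner_monomial, inner_self_eq_zero] at this

end Hardy

/-! ### Analytic Toeplitz operators -/

section Analytic

variable {E F : Type u} [NormedAddCommGroup E] [InnerProductSpace ℂ E]
  [NormedAddCommGroup F] [InnerProductSpace ℂ F]

theorem LInfty.coeFn_laurent (Φ : LInfty E F) (f : L2 E) :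
    (Φ.laurent f : 𝕋 → F) =ᵐ[μT] fun t => Φ.toFun t (f t) :=
  (Φ.memLp_apply f).coeFn_toLp

theorem integral_eq_circleAverage [CompleteSpace F] (g : ℂ → F) :
    ∫ t : 𝕋, g (AddCircle.toCircle t : ℂ) ∂μT = Real.circleAverage g 0 1 := by
  have h1 : ∫ t : 𝕋, g (AddCircle.toCircle t : ℂ) ∂μT
      = ∫ s in (0 : ℝ)..1, g (AddCircle.toCircle ((s : ℝ) : 𝕋) : ℂ) := by
    have := AddCircle.intervalIntegral_preimage 1 0
      (fun t : 𝕋 => g (AddCircle.toCircle t : ℂ))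
    rw [zero_add] at this
    rw [this, AddCircle.integral_haarAddCircle, inv_one, one_smul]
  have h2 := intervalIntegral.integral_comp_mul_left (a := 0) (b := 1)
    (fun θ => g (circleMap 0 1 θ)) (c := 2 * Real.pi) (by positivity)
  rw [mul_zero, mul_one] at h2
  rw [h1, Real.circleAverage_def, ← h2]
  refine intervalIntegral.integral_congr fun s _ => ?_
  simp only [AddCircle.toCircle_apply_mk, Circle.coe_exp, circleMap]
  simp

/-- The negative Fourier coefficients of an analytic function on a circle vanish. -/
theorem HInfty.fourierCoeff_dilate [CompleteSpace F] (Θ : HInfty E F) (x : E) {r : ℝ}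
    (h0 : 0 ≤ r) (h1 : r < 1) {n : ℤ} (hn : n < 0) :
    fourierCoeff (fun t : 𝕋 => Θ.toFun ((r : ℂ) * (AddCircle.toCircle t : ℂ)) x) n = 0 := by
  obtain ⟨m, rfl⟩ : ∃ m : ℕ, n = -((m : ℤ) + 1) := ⟨(-n - 1).toNat, by omega⟩
  -- The coefficient of index `-(m+1)` is the mean of `z^(m+1) Θ(rz) x`, hence its value at the
  -- centre, which is `0` because `m + 1 > 0`.
  have key := integral_eq_circleAverage fun z : ℂ => z ^ (m + 1) • Θ.toFun ((r : ℂ) * z) x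
  rw [DiffContOnCl.circleAverage] at key
  · rw [fourierCoeff]
    simp only [zero_pow (Nat.succ_ne_zero m), zero_smul] at key
    rw [← key]
    refine integral_congr_ae (Eventually.of_forall fun t => ?_)
    simp only [neg_neg, fourier_apply, AddCircle.toCircle_zsmul]
    norm_cast
  · apply DifferentiableOn.diffContOnCl
    rw [abs_one, closure_ball _ one_ne_zero]
    refine (differentiableOn_id.pow _).smul (DifferentiableOn.clm_apply ?_
      (differentiableOn_const x))
    refine Θ.analytic.comp (by fun_prop) fun z hz => ?_
    rw [mem_closedBall_zero_iff] at hz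
    rw [mem_ball_zero_iff, norm_mul, Complex.norm_real, Real.norm_of_nonneg h0]
    nlinarith [norm_nonneg z]

/-- Let `r ↑ 1` in `HInfty.fourierCoeff_dilate`, by dominated convergence. If no radial limit
exists, the boundary function is `0` by default and the claim still holds. -/
theorem HInfty.fourierCoeff_boundary [CompleteSpace F] (Θ : HInfty E F) (x : E) {n : ℤ}
    (hn : n < 0) : fourierCoeff (fun t => Θ.boundary.toFun t x) n = 0 := by
  by_cases h : ∃ φ, Θ.IsRadialLimit φ
  · have hb : Θ.IsRadialLimit Θ.boundary.toFun := by
      rw [HInfty.boundary, dif_pos h]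
      exact h.choose_spec
    obtain ⟨C, hC⟩ := Θ.bdd
    obtain ⟨u, -, hu, hlim⟩ := exists_seq_strictMono_tendsto' (zero_lt_one' ℝ)
    have hlim' : Tendsto u atTop (𝓝[<] 1) :=
      tendsto_nhdsWithin_iff.2 ⟨hlim, Eventually.of_forall fun n => (hu n).2⟩
    have key : Tendsto (fun j => fourierCoeff
        (fun t : 𝕋 => Θ.toFun ((u j : ℂ) * (AddCircle.toCircle t : ℂ)) x) n) atTop
        (𝓝 (fourierCoeff (fun t => Θ.boundary.toFun t x) n)) := by
      refine tendsto_integral_of_dominated_convergence (fun _ => C * ‖x‖) (fun j => ?_)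
        (integrable_const _) (fun j => Eventually.of_forall fun t => ?_) ?_
      · apply Continuous.aestronglyMeasurable
        have hc : Continuous fun t : 𝕋 => ((u j : ℂ) * (AddCircle.toCircle t : ℂ)) :=
          continuous_const.mul (continuous_subtype_val.comp AddCircle.continuous_toCircle)
        have := (Θ.analytic.continuousOn.comp_continuous hc
          (fun t => HInfty.mul_mem_ball (hu j).1.le (hu j).2 t)).clm_apply
          (continuous_const (y := x))
        fun_prop
      · rw [norm_smul, norm_fourier_apply, one_mul]
        exact (Θ.toFun _).le_of_opNorm_le
          (hC _ (HInfty.mul_mem_ball (hu j).1.le (hu j).2 t)) _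
      · filter_upwards [hb] with t ht
        exact ((ht x).comp hlim').const_smul _
    refine tendsto_nhds_unique key ?_
    simp_rw [fun j => Θ.fourierCoeff_dilate x (hu j).1.le (hu j).2 hn]
    exact tendsto_const_nhds
  · rw [HInfty.boundary, dif_neg h]
    simp [fourierCoeff]

variable [CompleteSpace E] [TopologicalSpace.SeparableSpace E] [CompleteSpace F]

theorem HInfty.laurent_mem (Θ : HInfty E F) (f : H2 E) : Θ.boundary.laurent f ∈ H2 F := by
  let L : H2 E →L[ℂ] L2 F := Θ.boundary.laurent ∘L (H2 E).subtypeL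
  suffices (H2 F).comap L.toLinearMap = ⊤ from
    (this ▸ Submodule.mem_top : f ∈ (H2 F).comap L.toLinearMap)
  refine H2.eq_top_of_monomial_mem _ ((isClosed_H2 F).preimage L.continuous) fun m x n hn => ?_
  have : (L (monomial m x) : 𝕋 → F) =ᵐ[μT]
      fun t => fourier (m : ℤ) t • Θ.boundary.toFun t x := by
    filter_upwards [Θ.boundary.coeFn_laurent (monomial m x), H2.coeFn_monomial m x] with t h1 h2
    change (Θ.boundary.laurent (monomial m x) : 𝕋 → F) t = _
    rw [h1, h2, map_smul]
  change fourierCoeff (L (monomial m x) : 𝕋 → F) n = 0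
  rw [fourierCoeff_congr_ae this, fourierCoeff_fourier_smul]
  exact Θ.fourierCoeff_boundary x (by omega)

/-- An analytic Toeplitz operator is multiplication by its symbol. -/
theorem HInfty.coeFn_toeplitz (Θ : HInfty E F) (f : H2 E) :
    ((Θ.toeplitz f : L2 F) : 𝕋 → F) =ᵐ[μT] fun t => Θ.boundary.toFun t ((f : L2 E) t) := by
  have : (Θ.toeplitz f : L2 F) = Θ.boundary.laurent f :=
    congrArg Subtype.val
      ((H2 F).orthogonalProjectionOnto_mem_subspace_eq_self ⟨_, Θ.laurent_mem f⟩)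
  rw [this]
  exact Θ.boundary.coeFn_laurent f

theorem HInfty.IsInner.norm_toeplitz {Θ : HInfty E F} (h : Θ.IsInner) (f : H2 E) :
    ‖Θ.toeplitz f‖ = ‖f‖ := by
  change ‖(Θ.toeplitz f : L2 F)‖ = ‖(f : L2 E)‖
  rw [Lp.norm_def, Lp.norm_def]
  congr 1
  refine eLpNorm_congr_norm_ae ?_
  filter_upwards [h, Θ.coeFn_toeplitz f] with t h1 h2
  rw [h2]
  exact (ContinuousLinearMap.norm_map_iff_adjoint_comp_self _).2 h1 _

theorem HInfty.IsInner.inner_toeplitz {Θ : HInfty E F} (h : Θ.IsInner) (f g : H2 E) :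
    inner ℂ (Θ.toeplitz f) (Θ.toeplitz g) = inner ℂ f g :=
  (⟨Θ.toeplitz.toLinearMap, h.norm_toeplitz⟩ : H2 E →ₗᵢ[ℂ] H2 F).inner_map_map f g

end Analytic

/-! ### Multiplication by powers of the coordinate -/

section Shift

variable {E : Type u} [NormedAddCommGroup E] [InnerProductSpace ℂ E] [CompleteSpace E]

theorem H2.coeFn_Mz (k : ℕ) (f : H2 E) :
    ((Mz E k f : L2 E) : 𝕋 → E) =ᵐ[μT] fun t => fourier (k : ℤ) t • (f : L2 E) t := by
  have h1 : ((zPow E k).laurent f : 𝕋 → E) =ᵐ[μT] fun t => fourier (k : ℤ) t • (f : L2 E) t :=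
    (zPow E k).coeFn_laurent f
  have hmem : (zPow E k).laurent f ∈ H2 E := by
    intro n hn
    rw [fourierCoeff_congr_ae h1, fourierCoeff_fourier_smul]
    exact f.2 _ (by omega)
  have h2 : (Mz E k f : L2 E) = (zPow E k).laurent f :=
    congrArg Subtype.val ((H2 E).orthogonalProjectionOnto_mem_subspace_eq_self ⟨_, hmem⟩)
  rw [h2]
  exact h1

omit [CompleteSpace E] in
theorem H2.ext_ae {f g : H2 E} (h : ((f : L2 E) : 𝕋 → E) =ᵐ[μT] ((g : L2 E) : 𝕋 → E)) : f = g :=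
  Subtype.ext (Lp.ext h)

theorem H2.coeff_Mz_of_lt {n k : ℕ} (h : n < k) (f : H2 E) : H2.coeff n (Mz E k f) = 0 := by
  rw [H2.coeff_apply, fourierCoeff_congr_ae (H2.coeFn_Mz k f), fourierCoeff_fourier_smul]
  exact f.2 _ (by omega)

theorem H2.coeff_Mz_add (n k : ℕ) (f : H2 E) : H2.coeff (n + k) (Mz E k f) = H2.coeff n f := by
  rw [H2.coeff_apply, fourierCoeff_congr_ae (H2.coeFn_Mz k f), fourierCoeff_fourier_smul,
    H2.coeff_apply]
  simp

theorem H2.Mz_zero (f : H2 E) : Mz E 0 f = f := by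
  refine H2.ext_ae ?_
  filter_upwards [H2.coeFn_Mz 0 f] with t h
  rw [h, Nat.cast_zero, fourier_zero, one_smul]

theorem H2.Mz_Mz (a b : ℕ) (f : H2 E) : Mz E a (Mz E b f) = Mz E (a + b) f := by
  refine H2.ext_ae ?_
  filter_upwards [H2.coeFn_Mz a (Mz E b f), H2.coeFn_Mz b f, H2.coeFn_Mz (a + b) f]
    with t h1 h2 h3
  rw [h1, h2, h3, smul_smul, Nat.cast_add, fourier_add]

theorem H2.Mz_monomial (a b : ℕ) (x : E) : Mz E a (monomial b x) = monomial (a + b) x := by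
  refine H2.ext_ae ?_
  filter_upwards [H2.coeFn_Mz a (monomial b x), H2.coeFn_monomial b x,
    H2.coeFn_monomial (a + b) x] with t h1 h2 h3
  rw [h1, h2, h3, smul_smul, Nat.cast_add, fourier_add]

theorem H2.Mz_mem_of_shift_invariant {N : Submodule ℂ (H2 E)} (hN : ∀ f ∈ N, Mz E 1 f ∈ N)
    (k : ℕ) {f : H2 E} (hf : f ∈ N) : Mz E k f ∈ N := by
  induction k with
  | zero => rwa [H2.Mz_zero]
  | succ k ih =>
    rw [add_comm, ← H2.Mz_Mz]
    exact hN _ ih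

/-- The first `k` Taylor coefficients. -/
noncomputable def trunc (k : ℕ) : H2 E →L[ℂ] Ek E k :=
  (PiLp.continuousLinearEquiv 2 ℂ (fun _ : Fin k => E)).symm.toContinuousLinearMap ∘L
    ContinuousLinearMap.pi fun i : Fin k => H2.coeff i.val

omit [CompleteSpace E] in
theorem trunc_apply (k : ℕ) (f : H2 E) (i : Fin k) : trunc k f i = H2.coeff i.val f := rfl

omit [CompleteSpace E] in
theorem J_apply (k : ℕ) (x : Ek E k) (i : Fin k) :
    J E k x i = if 0 < i.val then x ⟨i.val - 1, (Nat.sub_le _ _).trans_lt i.isLt⟩ else 0 := by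
  change (if 0 < i.val then ContinuousLinearMap.proj (R := ℂ) (φ := fun _ : Fin k => E)
    (⟨i.val - 1, (Nat.sub_le _ _).trans_lt i.isLt⟩ : Fin k) else 0 : (Fin k → E) →L[ℂ] E) _ = _
  split_ifs <;> rfl

theorem trunc_Mz (k : ℕ) (f : H2 E) : trunc k (Mz E k f) = 0 := by
  ext i
  exact H2.coeff_Mz_of_lt i.isLt f

/-- This intertwining turns questions about `J` into questions about multiplication by `z`. -/
theorem trunc_Mz_one (k : ℕ) (f : H2 E) : trunc k (Mz E 1 f) = J E k (trunc k f) := by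
  ext i
  rw [J_apply, trunc_apply]
  split_ifs with h
  · rw [trunc_apply, ← H2.coeff_Mz_add _ 1 f]
    congr 2
    simp only
    omega
  · exact H2.coeff_Mz_of_lt (by omega) f

theorem embed_apply (k : ℕ) (x : Ek E k) : embed E k x = ∑ i : Fin k, monomial i.val (x i) := rfl

theorem trunc_embed (k : ℕ) (x : Ek E k) : trunc k (embed E k x) = x := by
  ext i
  rw [trunc_apply, embed_apply, map_sum, Finset.sum_eq_single i]
  · simp [H2.coeff_monomial]
  · intro j _ hj
    rw [H2.coeff_monomial, if_neg fun h => hj (Fin.ext h.symm)]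
  · simp

theorem inner_embed_Mz (k : ℕ) (x : Ek E k) (g : H2 E) :
    inner ℂ (embed E k x) (Mz E k g) = 0 := by
  rw [embed_apply, sum_inner]
  refine Finset.sum_eq_zero fun i _ => ?_
  rw [H2.inner_monomial, H2.coeff_Mz_of_lt i.isLt, inner_zero_right]

theorem H2.exists_eq_Mz (k : ℕ) (f : H2 E) (hf : ∀ n < k, H2.coeff n f = 0) :
    ∃ g, f = Mz E k g := by
  -- Divide by `z^k` in `L²`; the vanishing of the first `k` coefficients puts the quotient in `H²`.
  have hmem : MemLp (fun t => fourier (-(k : ℤ)) t • (f : L2 E) t) 2 μT := by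
    refine (Lp.memLp (f : L2 E)).of_le_mul (c := 1)
      ((map_continuous (fourier _)).aestronglyMeasurable.smul (Lp.memLp _).1)
      (Eventually.of_forall fun t => ?_)
    rw [norm_smul, norm_fourier_apply]
  have hH : hmem.toLp ∈ H2 E := by
    intro n hn
    rw [fourierCoeff_congr_ae hmem.coeFn_toLp, fourierCoeff_fourier_smul, sub_neg_eq_add]
    rcases lt_or_ge (n + k) 0 with h | h
    · exact f.2 _ h
    · have := hf (n + k).toNat (by omega)
      rwa [H2.coeff_apply, Int.toNat_of_nonneg h] at this
  refine ⟨⟨_, hH⟩, H2.ext_ae ?_⟩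
  filter_upwards [H2.coeFn_Mz k ⟨_, hH⟩, hmem.coeFn_toLp] with t h1 h2
  rw [h1, h2, smul_smul, ← fourier_add, add_neg_cancel, fourier_zero, one_smul]

theorem exists_eq_embed_add_Mz (k : ℕ) (f : H2 E) :
    ∃ g, f = embed E k (trunc k f) + Mz E k g := by
  obtain ⟨g, hg⟩ := H2.exists_eq_Mz k (f - embed E k (trunc k f)) fun n hn => by
    have := congrArg (fun x : Ek E k => x ⟨n, hn⟩) (trunc_embed k (trunc k f))
    simp only [trunc_apply] at this
    rw [map_sub, this, sub_self]
  exact ⟨g, by rw [← hg]; abel⟩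

theorem H2.exists_eq_monomial_add_Mz (f : H2 E) : ∃ x g, f = monomial 0 x + Mz E 1 g := by
  obtain ⟨g, hg⟩ := exists_eq_embed_add_Mz 1 f
  refine ⟨trunc 1 f 0, g, hg.trans ?_⟩
  rw [embed_apply, Fin.sum_univ_one]
  rfl

end Shift

/-! ### Analytic Toeplitz operators and the shift; sufficiency of the factorization -/

section Toeplitz

variable {E F : Type u} [NormedAddCommGroup E] [InnerProductSpace ℂ E] [CompleteSpace E]
  [NormedAddCommGroup F] [InnerProductSpace ℂ F] [CompleteSpace F]
  [TopologicalSpace.SeparableSpace E]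

theorem HInfty.toeplitz_Mz (Θ : HInfty E F) (k : ℕ) (f : H2 E) :
    Θ.toeplitz (Mz E k f) = Mz F k (Θ.toeplitz f) := by
  refine H2.ext_ae ?_
  filter_upwards [Θ.coeFn_toeplitz (Mz E k f), Θ.coeFn_toeplitz f, H2.coeFn_Mz k f,
    H2.coeFn_Mz k (Θ.toeplitz f)] with t h1 h2 h3 h4
  rw [h1, h3, h4, h2, map_smul]

/-- The subspace `Θ (ker T_Φ^*)` is invariant under the truncated shift. -/
theorem J_mem_of_factorization [TopologicalSpace.SeparableSpace F] {k : ℕ}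
    {M : Submodule ℂ (Ek E k)} {Θ : HInfty F E} {Φ : HInfty E F} (hΦ : Φ.IsInner)
    (hΘΦ : Θ.toeplitz ∘L Φ.toeplitz = Mz E k)
    (hM : embed E k '' (M : Set (Ek E k)) =
      Θ.toeplitz '' {h : H2 F | ContinuousLinearMap.adjoint Φ.toeplitz h = 0})
    {x : Ek E k} (hx : x ∈ M) : J E k x ∈ M := by
  obtain ⟨h, -, hh⟩ : embed E k x ∈
      Θ.toeplitz '' {h : H2 F | ContinuousLinearMap.adjoint Φ.toeplitz h = 0} :=
    hM ▸ Set.mem_image_of_mem _ hx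
  set Ts := ContinuousLinearMap.adjoint Φ.toeplitz with hTs
  have hiso : ∀ u, Ts (Φ.toeplitz u) = u := by
    intro u
    refine ext_inner_right ℂ fun v => ?_
    rw [hTs, ContinuousLinearMap.adjoint_inner_left, hΦ.inner_toeplitz]
  set g := Mz F 1 h with hg
  -- `zh` need not lie in the kernel; its projection onto the kernel along `Φ H²` does.
  have hker : g - Φ.toeplitz (Ts g) ∈ {h : H2 F | Ts h = 0} := by
    change Ts (g - Φ.toeplitz (Ts g)) = 0
    rw [map_sub, hiso, sub_self]
  obtain ⟨y, hy, hyg⟩ : Θ.toeplitz (g - Φ.toeplitz (Ts g)) ∈ embed E k '' (M : Set (Ek E k)) :=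
    hM ▸ Set.mem_image_of_mem _ hker
  have hTT : Θ.toeplitz (Φ.toeplitz (Ts g)) = Mz E k (Ts g) := DFunLike.congr_fun hΘΦ _
  have key : J E k x = y := by
    rw [← trunc_embed k x, ← trunc_Mz_one, ← hh, ← HInfty.toeplitz_Mz, ← hg,
      ← sub_add_cancel g (Φ.toeplitz (Ts g)), map_add, map_add, hTT, trunc_Mz, add_zero, ← hyg,
      trunc_embed]
  exact key ▸ hy

end Toeplitz

/-! ### Entire symbols -/

section Entire

variable {E F G : Type u} [NormedAddCommGroup E] [InnerProductSpace ℂ E]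
  [NormedAddCommGroup F] [InnerProductSpace ℂ F] [NormedAddCommGroup G] [InnerProductSpace ℂ G]

/-- An entire operator-valued function, as an element of `H^∞`. -/
noncomputable def HInfty.ofEntire (A : ℂ → E →L[ℂ] F) (hA : Differentiable ℂ A) : HInfty E F where
  toFun := A
  analytic := hA.differentiableOn
  bdd := by
    obtain ⟨C, hC⟩ := (isCompact_closedBall (0 : ℂ) 1).exists_bound_of_continuousOn
      hA.continuous.continuousOn
    exact ⟨C, fun z hz => hC z (Metric.ball_subset_closedBall hz)⟩

/-- The radial limits exist by continuity. The equality is only almost everywhere because `boundary`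
is an arbitrary choice of radial limit. -/
theorem HInfty.boundary_ofEntire {A : ℂ → E →L[ℂ] F} (hA : Differentiable ℂ A) :
    ∀ᵐ t ∂μT, (HInfty.ofEntire A hA).boundary.toFun t = A (AddCircle.toCircle t : ℂ) := by
  have hlim : ∀ (t : 𝕋) (x : E), Tendsto
      (fun r : ℝ => (HInfty.ofEntire A hA).toFun ((r : ℂ) * (AddCircle.toCircle t : ℂ)) x)
      (𝓝[<] 1) (𝓝 (A (AddCircle.toCircle t : ℂ) x)) := by
    intro t x
    have hA' := hA.continuous
    have : Continuous fun r : ℝ => A ((r : ℂ) * (AddCircle.toCircle t : ℂ)) x := by fun_prop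
    have h := (this.tendsto 1).mono_left (nhdsWithin_le_nhds (s := Set.Iio 1))
    rwa [Complex.ofReal_one, one_mul] at h
  have hex : ∃ φ, (HInfty.ofEntire A hA).IsRadialLimit φ :=
    ⟨fun t => A (AddCircle.toCircle t : ℂ), Eventually.of_forall hlim⟩
  rw [HInfty.boundary, dif_pos hex]
  filter_upwards [hex.choose_spec] with t ht
  ext x
  exact tendsto_nhds_unique (ht x) (hlim t x)

variable [CompleteSpace E] [CompleteSpace F] [CompleteSpace G]

theorem HInfty.isInner_ofEntire {A : ℂ → E →L[ℂ] F} (hA : Differentiable ℂ A)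
    (h : ∀ z : ℂ, ‖z‖ = 1 → ∀ x, ‖A z x‖ = ‖x‖) : (HInfty.ofEntire A hA).IsInner := by
  filter_upwards [HInfty.boundary_ofEntire hA] with t ht
  rw [ht]
  exact (ContinuousLinearMap.norm_map_iff_adjoint_comp_self _).1 (h _ (Circle.norm_coe _))

variable [TopologicalSpace.SeparableSpace E]

theorem HInfty.coeFn_toeplitz_ofEntire {A : ℂ → E →L[ℂ] F} (hA : Differentiable ℂ A) (f : H2 E) :
    (((HInfty.ofEntire A hA).toeplitz f : L2 F) : 𝕋 → F) =ᵐ[μT]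
      fun t => A (AddCircle.toCircle t : ℂ) ((f : L2 E) t) := by
  filter_upwards [(HInfty.ofEntire A hA).coeFn_toeplitz f, HInfty.boundary_ofEntire hA] with t h1 h2
  rw [h1, h2]

theorem HInfty.toeplitz_ofEntire_comp [TopologicalSpace.SeparableSpace F] {A : ℂ → F →L[ℂ] G}
    (hA : Differentiable ℂ A) {B : ℂ → E →L[ℂ] F} (hB : Differentiable ℂ B)
    (hAB : Differentiable ℂ fun z => A z ∘L B z) (f : H2 E) :
    (HInfty.ofEntire A hA).toeplitz ((HInfty.ofEntire B hB).toeplitz f) =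
      (HInfty.ofEntire _ hAB).toeplitz f := by
  refine H2.ext_ae ?_
  filter_upwards [HInfty.coeFn_toeplitz_ofEntire hA ((HInfty.ofEntire B hB).toeplitz f),
    HInfty.coeFn_toeplitz_ofEntire hB f, HInfty.coeFn_toeplitz_ofEntire hAB f] with t h1 h2 h3
  rw [h1, h2, h3]
  rfl

theorem HInfty.toeplitz_ofEntire_comp_eq_Mz [TopologicalSpace.SeparableSpace F] {k : ℕ}
    {A : ℂ → F →L[ℂ] E} (hA : Differentiable ℂ A) {B : ℂ → E →L[ℂ] F} (hB : Differentiable ℂ B)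
    (hAB : ∀ z x, A z (B z x) = z ^ k • x) (f : H2 E) :
    (HInfty.ofEntire A hA).toeplitz ((HInfty.ofEntire B hB).toeplitz f) = Mz E k f := by
  refine H2.ext_ae ?_
  filter_upwards [HInfty.coeFn_toeplitz_ofEntire hA ((HInfty.ofEntire B hB).toeplitz f),
    HInfty.coeFn_toeplitz_ofEntire hB f, H2.coeFn_Mz k f] with t h1 h2 h3
  rw [h1, h2, h3, hAB, fourier_apply, AddCircle.toCircle_zsmul]
  simp

end Entire

/-! ### Factorization of the invariant subspaces containing `z^k H²` -/

section Factorization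

variable {E : Type u} [NormedAddCommGroup E] [InnerProductSpace ℂ E] [CompleteSpace E]

omit [CompleteSpace E] in
theorem norm_smul_starProjection_add (K : Submodule ℂ E) [K.HasOrthogonalProjection] {a b : ℂ}
    (ha : ‖a‖ = 1) (hb : ‖b‖ = 1) (x : E) :
    ‖a • K.starProjection x + b • Kᗮ.starProjection x‖ = ‖x‖ := by
  have h0 : inner ℂ (a • K.starProjection x) (b • Kᗮ.starProjection x) = 0 := by
    rw [inner_smul_left, inner_smul_right,
      K.inner_right_of_mem_orthogonal (K.starProjection_apply_mem x)
        (Kᗮ.starProjection_apply_mem x), mul_zero, mul_zero]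
  rw [← sq_eq_sq₀ (norm_nonneg _) (norm_nonneg _), sq,
    norm_add_sq_eq_norm_sq_add_norm_sq_of_inner_eq_zero _ _ h0,
    norm_smul, norm_smul, ha, hb, one_mul, one_mul, ← sq, ← sq,
    ← K.norm_sq_eq_add_norm_sq_starProjection x]

/-- The Blaschke–Potapov factor `z ↦ P + z (1 - P)`, with `P` the projection onto `K`. -/
noncomputable def potapov (K : Submodule ℂ E) [K.HasOrthogonalProjection] (z : ℂ) : E →L[ℂ] E :=
  K.starProjection + z • Kᗮ.starProjection

/-- The complementary factor `z ↦ z P + (1 - P)`, with `P` the projection onto `K`. -/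
noncomputable def potapovDual (K : Submodule ℂ E) [K.HasOrthogonalProjection] (z : ℂ) :
    E →L[ℂ] E :=
  z • K.starProjection + Kᗮ.starProjection

section Potapov

variable (K : Submodule ℂ E) [K.HasOrthogonalProjection]

omit [CompleteSpace E] in
theorem potapov_apply (z : ℂ) (x : E) :
    potapov K z x = K.starProjection x + z • Kᗮ.starProjection x := rfl

omit [CompleteSpace E] in
theorem potapovDual_apply (z : ℂ) (x : E) :
    potapovDual K z x = z • K.starProjection x + Kᗮ.starProjection x := rfl

theorem differentiable_potapov : Differentiable ℂ (potapov K) := by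
  unfold potapov
  fun_prop

theorem differentiable_potapovDual : Differentiable ℂ (potapovDual K) := by
  unfold potapovDual
  fun_prop

omit [CompleteSpace E] in
theorem norm_potapov_apply {z : ℂ} (hz : ‖z‖ = 1) (x : E) : ‖potapov K z x‖ = ‖x‖ := by
  rw [potapov_apply, ← norm_smul_starProjection_add K norm_one hz x, one_smul]

omit [CompleteSpace E] in
theorem norm_potapovDual_apply {z : ℂ} (hz : ‖z‖ = 1) (x : E) : ‖potapovDual K z x‖ = ‖x‖ := by
  rw [potapovDual_apply, ← norm_smul_starProjection_add K hz norm_one x, one_smul]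

omit [CompleteSpace E] in
theorem potapov_apply_of_mem (z : ℂ) {x : E} (hx : x ∈ K) : potapov K z x = x := by
  have h := K.starProjection_add_starProjection_orthogonal x
  rw [K.starProjection_eq_self_iff.2 hx, add_eq_left] at h
  rw [potapov_apply, h, smul_zero, add_zero, K.starProjection_eq_self_iff.2 hx]

omit [CompleteSpace E] in
theorem potapov_apply_of_mem_orthogonal (z : ℂ) {x : E} (hx : x ∈ Kᗮ) :
    potapov K z x = z • x := by
  have h := K.starProjection_add_starProjection_orthogonal x
  rw [Kᗮ.starProjection_eq_self_iff.2 hx, add_eq_right] at h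
  rw [potapov_apply, h, zero_add, Kᗮ.starProjection_eq_self_iff.2 hx]

/-- On each of `K` and `Kᗮ` exactly one of the two factors supplies `z`, and the other is the
identity. -/
theorem potapov_potapovDual (z : ℂ) (x : E) : potapov K z (potapovDual K z x) = z • x := by
  rw [potapovDual_apply, map_add, map_smul,
    potapov_apply_of_mem K z (K.starProjection_apply_mem x),
    potapov_apply_of_mem_orthogonal K z (Kᗮ.starProjection_apply_mem x), ← smul_add,
    K.starProjection_add_starProjection_orthogonal]

variable [TopologicalSpace.SeparableSpace E]

theorem toeplitz_potapov_monomial_zero (x : E) :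
    (HInfty.ofEntire _ (differentiable_potapov K)).toeplitz (monomial 0 x) =
      monomial 0 (K.starProjection x) + monomial 1 (Kᗮ.starProjection x) := by
  refine H2.ext_ae ?_
  filter_upwards [HInfty.coeFn_toeplitz_ofEntire (differentiable_potapov K) (monomial 0 x),
    H2.coeFn_monomial 0 x, H2.coeFn_monomial 0 (K.starProjection x),
    H2.coeFn_monomial 1 (Kᗮ.starProjection x),
    Lp.coeFn_add (monomial 0 (K.starProjection x) : L2 E) (monomial 1 (Kᗮ.starProjection x))]
    with t h1 h2 h3 h4 h5
  refine h1.trans (Eq.trans ?_ h5.symm)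
  rw [Pi.add_apply, h2, h3, h4]
  simp [potapov_apply]

end Potapov

variable [TopologicalSpace.SeparableSpace E]

/-- A closed shift-invariant subspace `N ⊇ z^{k+1} H²` is the image under a Blaschke–Potapov factor
of one containing `z^k H²`. -/
theorem exists_potapov (k : ℕ) (N : Submodule ℂ (H2 E)) (hcl : IsClosed (N : Set (H2 E)))
    (hshift : ∀ f ∈ N, Mz E 1 f ∈ N) (hk : ∀ f, Mz E (k + 1) f ∈ N) :
    ∃ (K : Submodule ℂ E) (_ : K.HasOrthogonalProjection) (T : H2 E →L[ℂ] H2 E),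
      T = (HInfty.ofEntire _ (differentiable_potapov K)).toeplitz ∧
      (∀ f, T (Mz E k f) ∈ N) ∧ ∀ f ∈ N, ∃ g, T g = f := by
  -- `K` collects the vectors `x` with `z^k x ∈ N`.
  let K : Submodule ℂ E := N.comap (monomial k)
  have hmemK : ∀ x, x ∈ K ↔ monomial k x ∈ N := fun x => Iff.rfl
  have hK : IsClosed (K : Set E) := hcl.preimage (H2.continuous_monomial k)
  clear_value K
  have : CompleteSpace K := hK.completeSpace_coe
  obtain ⟨T, hT⟩ : ∃ T : H2 E →L[ℂ] H2 E,
    T = (HInfty.ofEntire _ (differentiable_potapov K)).toeplitz := ⟨_, rfl⟩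
  have hTMz : ∀ n f, T (Mz E n f) = Mz E n (T f) := fun n f => by rw [hT, HInfty.toeplitz_Mz]
  have hT0 : ∀ x, T (monomial 0 x) =
      monomial 0 (K.starProjection x) + monomial 1 (Kᗮ.starProjection x) := fun x => by
    rw [hT, toeplitz_potapov_monomial_zero]
  refine ⟨K, inferInstance, T, hT, fun f => ?_, fun f hf => ?_⟩
  -- For `f = x + zh`, `T (z^k f) = z^k Px + z^(k+1) ((1 - P)x + Th)`: the first term is in `N` by
  -- the choice of `K`, the rest by `hk`.
  · obtain ⟨x, h, rfl⟩ := H2.exists_eq_monomial_add_Mz f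
    rw [hTMz, map_add, map_add, hT0, map_add, hTMz, H2.Mz_Mz, H2.Mz_monomial, H2.Mz_monomial]
    refine N.add_mem (N.add_mem ((hmemK _).1 (K.starProjection_apply_mem x)) ?_) (hk _)
    rw [← add_zero (k + 1), ← H2.Mz_monomial]
    exact hk _
  · obtain ⟨x, h, rfl⟩ := H2.exists_eq_monomial_add_Mz f
    -- `z^k f = z^k x + z^(k+1) h` lies in `N`, and so does its last term.
    have hx : x ∈ K := by
      have h1 := H2.Mz_mem_of_shift_invariant hshift k hf
      rw [map_add, H2.Mz_Mz, H2.Mz_monomial] at h1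
      exact (hmemK x).2 ((N.add_mem_iff_left (hk h)).1 h1)
    -- The factor fixes `x ∈ K`, and composed with its complement it gives `zh`.
    refine ⟨monomial 0 x + (HInfty.ofEntire _ (differentiable_potapovDual K)).toeplitz h, ?_⟩
    have hx' := K.starProjection_add_starProjection_orthogonal x
    rw [K.starProjection_eq_self_iff.2 hx, add_eq_left] at hx'
    rw [map_add, hT0, K.starProjection_eq_self_iff.2 hx, hx', map_zero, add_zero, hT,
      HInfty.toeplitz_ofEntire_comp_eq_Mz (k := 1)]
    intro z y
    rw [potapov_potapovDual, pow_one]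

/-- Induction on `k`: the preimage of `N` under the factor from `exists_potapov` contains one more
power of `z`, and `N` is recovered as its image. For `k = 0`, `N` is all of `H²`. -/
theorem exists_factorization (k : ℕ) (N : Submodule ℂ (H2 E)) (hcl : IsClosed (N : Set (H2 E)))
    (hshift : ∀ f ∈ N, Mz E 1 f ∈ N) (hk : ∀ f, Mz E k f ∈ N) :
    ∃ (A C : ℂ → E →L[ℂ] E) (hA : Differentiable ℂ A) (_ : Differentiable ℂ C),
      (∀ z x, A z (C z x) = z ^ k • x) ∧ (∀ z : ℂ, ‖z‖ = 1 → ∀ x, ‖A z x‖ = ‖x‖) ∧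
      (∀ z : ℂ, ‖z‖ = 1 → ∀ x, ‖C z x‖ = ‖x‖) ∧
      ∀ f, f ∈ N ↔ ∃ g, (HInfty.ofEntire A hA).toeplitz g = f := by
  induction k generalizing N with
  | zero =>
    have hid : Differentiable ℂ fun _ : ℂ => ContinuousLinearMap.id ℂ E :=
      differentiable_const _
    refine ⟨_, _, hid, hid, by simp, by simp, by simp, fun f => ⟨fun _ => ⟨f, ?_⟩, fun _ => ?_⟩⟩
    · exact H2.ext_ae (HInfty.coeFn_toeplitz_ofEntire hid f)
    · rw [← H2.Mz_zero f]
      exact hk f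
  | succ k ih =>
    obtain ⟨K, _, T, hT, hTk, hTN⟩ := exists_potapov k N hcl hshift hk
    have hTMz : ∀ n f, T (Mz E n f) = Mz E n (T f) := fun n f => by rw [hT, HInfty.toeplitz_Mz]
    obtain ⟨A, C, hA, hC, hAC, hAn, hCn, hran⟩ := ih (N.comap T.toLinearMap)
      (hcl.preimage T.continuous)
      (fun f hf => by
        rw [Submodule.mem_comap, ContinuousLinearMap.coe_coe] at hf ⊢
        rw [hTMz]
        exact hshift _ hf)
      (fun f => by
        rw [Submodule.mem_comap, ContinuousLinearMap.coe_coe]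
        exact hTk f)
    simp only [Submodule.mem_comap, ContinuousLinearMap.coe_coe] at hran
    have hBA : Differentiable ℂ fun z => potapov K z ∘L A z :=
      (differentiable_potapov K).clm_comp hA
    have hTA : ∀ g, (HInfty.ofEntire _ hBA).toeplitz g = T ((HInfty.ofEntire A hA).toeplitz g) :=
      fun g => by rw [hT, HInfty.toeplitz_ofEntire_comp _ hA hBA]
    -- With `B` the factor and `B'` its complement, `(B A)(C B') = B z^k B' = z^(k+1)`, as `z^k` is
    -- scalar.
    refine ⟨_, fun z => C z ∘L potapovDual K z, hBA,
      hC.clm_comp (differentiable_potapovDual K), fun z x => ?_, fun z hz x => ?_,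
      fun z hz x => ?_, fun f => ⟨fun hf => ?_, ?_⟩⟩
    · rw [ContinuousLinearMap.comp_apply, ContinuousLinearMap.comp_apply, hAC, map_smul,
        potapov_potapovDual, smul_smul, pow_succ]
    · rw [ContinuousLinearMap.comp_apply, norm_potapov_apply K hz, hAn z hz]
    · rw [ContinuousLinearMap.comp_apply, hCn z hz, norm_potapovDual_apply K hz]
    · obtain ⟨h, rfl⟩ := hTN f hf
      obtain ⟨g, hg⟩ := (hran h).1 hf
      exact ⟨g, by rw [hTA, hg]⟩
    · rintro ⟨g, rfl⟩
      rw [hTA]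
      exact (hran _).2 ⟨g, rfl⟩

/-- A closed subspace invariant under the truncated shift is `Θ (ker T_Φ^*)` for a factorization
`z^k = Θ Φ` into inner functions. -/
theorem exists_factorization_of_J_mem {k : ℕ} {M : Submodule ℂ (Ek E k)}
    (hM : IsClosed (M : Set (Ek E k))) (hJ : ∀ x ∈ M, J E k x ∈ M) :
    ∃ Θ Φ : HInfty E E, Θ.IsInner ∧ Φ.IsInner ∧ Θ.toeplitz ∘L Φ.toeplitz = Mz E k ∧
      embed E k '' (M : Set (Ek E k)) =
        Θ.toeplitz '' {h : H2 E | ContinuousLinearMap.adjoint Φ.toeplitz h = 0} := by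
  obtain ⟨A, C, hA, hC, hAC, hAn, hCn, hran⟩ := exists_factorization k
    (M.comap (trunc k).toLinearMap) (hM.preimage (trunc k).continuous)
    (fun f hf => by
      change trunc k (Mz E 1 f) ∈ M
      rw [trunc_Mz_one]
      exact hJ _ hf)
    (fun f => by
      change trunc k (Mz E k f) ∈ M
      rw [trunc_Mz]
      exact M.zero_mem)
  have hΘ := HInfty.isInner_ofEntire hA hAn
  have hcomp := HInfty.toeplitz_ofEntire_comp_eq_Mz hA hC hAC
  refine ⟨.ofEntire A hA, .ofEntire C hC, hΘ, HInfty.isInner_ofEntire hC hCn,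
    ContinuousLinearMap.ext hcomp, Set.Subset.antisymm ?_ ?_⟩
  · rintro _ ⟨x, hx, rfl⟩
    obtain ⟨h, hh⟩ := (hran (embed E k x)).1 (by
      change trunc k (embed E k x) ∈ M
      rwa [trunc_embed])
    refine ⟨h, ?_, hh⟩
    -- `embed E k x = T_Θ h` is orthogonal to `z^k H² = Θ Φ H²`; as `T_Θ` is isometric, `h` is
    -- orthogonal to `Φ H²`.
    refine ext_inner_right ℂ fun g => ?_
    rw [ContinuousLinearMap.adjoint_inner_left, ← hΘ.inner_toeplitz, hh, hcomp, inner_embed_Mz,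
      inner_zero_left]
  · rintro _ ⟨h, hh, rfl⟩
    have hh' : ContinuousLinearMap.adjoint (HInfty.ofEntire C hC).toeplitz h = 0 := hh
    -- The component `z^k g` of `T_Θ h` vanishes, since `T_Θ h` is orthogonal to `Θ Φ H² = z^k H²`.
    obtain ⟨g, hg⟩ := exists_eq_embed_add_Mz k ((HInfty.ofEntire A hA).toeplitz h)
    have h0 : inner ℂ ((HInfty.ofEntire A hA).toeplitz h) (Mz E k g) = 0 := by
      rw [← hcomp, hΘ.inner_toeplitz, ← ContinuousLinearMap.adjoint_inner_left, hh',
        inner_zero_left]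
    rw [hg, inner_add_left, inner_embed_Mz, zero_add, inner_self_eq_zero] at h0
    rw [h0, add_zero] at hg
    exact ⟨_, (hran _).2 ⟨h, rfl⟩, hg.symm⟩

end Factorization

end HardyShift

theorem theorem4p3 {E : Type u} [NormedAddCommGroup E] [InnerProductSpace ℂ E] [CompleteSpace E]
    [TopologicalSpace.SeparableSpace E] (k : ℕ) (hk : 1 ≤ k)
    (M : Submodule ℂ (HardyShift.Ek E k)) (hM : IsClosed (M : Set (HardyShift.Ek E k))) :
    (∀ x ∈ M, HardyShift.J E k x ∈ M) ↔
      ∃ (F : Type u) (_ : NormedAddCommGroup F) (_ : InnerProductSpace ℂ F) (_ : CompleteSpace F),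
        Nonempty (F ≃ₗᵢ[ℂ] E) ∧
        ∃ (Θ : HardyShift.HInfty F E) (Φ : HardyShift.HInfty E F),
          Θ.IsInner ∧ Φ.IsInner ∧
          Θ.toeplitz ∘L Φ.toeplitz = HardyShift.Mz E k ∧
          HardyShift.embed E k '' (M : Set (HardyShift.Ek E k)) =
            Θ.toeplitz '' {h : HardyShift.H2 F | ContinuousLinearMap.adjoint Φ.toeplitz h = 0} := by
  constructor
  · intro hJ
    obtain ⟨Θ, Φ, h⟩ := HardyShift.exists_factorization_of_J_mem hM hJ
    exact ⟨E, _, _, inferInstance, ⟨.refl ℂ E⟩, Θ, Φ, h⟩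
  · rintro ⟨F, _, _, _, ⟨e⟩, Θ, Φ, -, hΦ, hΘΦ, himg⟩ x hx
    -- Separability passes from `E` to `F` along the isomorphism.
    have : TopologicalSpace.SeparableSpace F :=
      e.symm.surjective.denseRange.separableSpace e.symm.continuous
    exact HardyShift.J_mem_of_factorization hΦ hΘΦ himg hx
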